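/- An \emph{echeloned space} is a pair $\mathbf X=(X,\le_{\mathbf X})$ with $X\neq\emptyset$ a set and $\le_{\mathbf X}$ a total preorder on $X^2$ such that for all $x,y,z\in X$: $(x,x)\le_{\mathbf X}(y,z)$; if $(y,z)\le_{\mathbf X}(x,x)$ then $y=z$; and $(x,y)\le_{\mathbf X}(y,x)$. Write $p\sim_{\mathbf X}q$ if $p\le_{\mathbf X}q$ and $q\le_{\mathbf X}p$, let $E(\mathbf X)=X^2/{\sim_{\mathbf X}}$ carry the induced linear order, let $\eta_{\mathbf X}\colon X^2\to E(\mathbf X)$ be the quotient map, and let $\bot_{\mathbf X}$, the class of the pairs $(x,x)$, be the least element of $E(\mathbf X)$. Echeloned spaces are regarded as structures with one quaternary relation. For a set $C\ne\emptyset$, a \emph{$C$-coloured graph} is a pair $(V,\chi)$ with $V$ a set and $\chi\colon[V]^2\to C$, where $[V]^2$ is the set of two-element subsets of $V$; it is regarded as a structure with one binary relation $\{(u,v): u\ne v,\ \chi(\{u,v\})=c\}$ for each $c\in C$. For countable $C$, let $\mathcal T_C$ denote the countable universal homogeneous $C$-coloured graph, i.e. the Fraïssé limit of the class of all finite $C$-coloured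 graphs (unique up to isomorphism). \textbf{Theorem.} A countable universal homogeneous echeloned space, i.e. a Fraïssé limit of the class of all finite echeloned spaces, exists. Let $\mathbf F=(F,\le_{\mathbf F})$ be any such space and put $C=E(\mathbf F)\setminus\{\bot_{\mathbf F}\}$. (1) The $C$-coloured graph $(F,\chi)$ with $\chi(\{u,v\})=\eta_{\mathbf F}(u,v)$ is isomorphic to $\mathcal T_C$; that is, it is itself a Fraïssé limit of the class of all finite $C$-coloured graphs, and it is isomorphic to every other countable such limit. (2) Let $S\subseteq C$ be finite and non-empty, let $c_*\notin E(\mathbf F)$ be a new colour, and put $\chi_S(\{u,v\})=\eta_{\mathbf F}(u,v)$ if $\eta_{\mathbf F}(u,v)\in S$ and $\chi_S(\{u,v\})=c_*$ otherwise. Then the $S\cup\{c_*\}$-coloured graph $(F,\chi_S)$ is, in the same sense, isomorphic to $\mathcal T_{S\cup\{c_*\}}$. (3) For each $c\in C$, the graph on $F$ whose edges are the pairs $\{u,v\}$ with $\eta_{\mathbf F}(u,v)=c$ is isomorphic to the Rado graph. -/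

import Mathlib

universe u

open FirstOrder

/-! ### Echeloned spaces -/

/-- An echelon on a non-empty set `X`: a total preorder `le` on `X × X` such that the identical
pairs are below all pairs, only identical pairs are below an identical pair, and `(x, y)` is
below `(y, x)`. -/
class EchelonedSpace (X : Type u) where
  nonempty : Nonempty X
  le : X × X → X × X → Prop
  le_refl : ∀ p, le p p
  le_trans : ∀ p q r, le p q → le q r → le p r
  le_total : ∀ p q, le p q ∨ le q p
  diag_le : ∀ x y z : X, le (x, x) (y, z)
  eq_of_le_diag : ∀ x y z : X, le (y, z) (x, x) → y = z
  le_swap : ∀ x y : X, le (x, y) (y, x)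

namespace EchelonedSpace

/-- `p ∼ q` if and only if `p ≤ q` and `q ≤ p`. -/
instance pairSetoid (X : Type u) [EchelonedSpace X] : Setoid (X × X) where
  r p q := le p q ∧ le q p
  iseqv :=
    { refl := fun p => ⟨le_refl p, le_refl p⟩
      symm := fun h => ⟨h.2, h.1⟩
      trans := fun h k => ⟨le_trans _ _ _ h.1 k.1, le_trans _ _ _ k.2 h.2⟩ }

/-- The echeloning `E(X)`: the quotient of `X × X` by `∼`. -/
def Echeloning (X : Type u) [EchelonedSpace X] : Type u := Quotient (pairSetoid X)

/-- The quotient map `η : X × X → E(X)`. -/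
def eta {X : Type u} [EchelonedSpace X] (p : X × X) : Echeloning X := Quotient.mk (pairSetoid X) p

/-- The linear order on `E(X)` induced by the echelon. -/
noncomputable instance (X : Type u) [EchelonedSpace X] : LinearOrder (Echeloning X) where
  le := Quotient.lift₂ (fun p q => EchelonedSpace.le p q) (by
    intro a b c d hac hbd
    exact propext ⟨fun h => le_trans _ _ _ (le_trans _ _ _ hac.2 h) hbd.1,
      fun h => le_trans _ _ _ (le_trans _ _ _ hac.1 h) hbd.2⟩)
  le_refl a := Quotient.inductionOn a fun p => EchelonedSpace.le_refl p
  le_trans a b c := Quotient.inductionOn₃ a b c fun p q r => EchelonedSpace.le_trans p q r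
  le_antisymm a b := Quotient.inductionOn₂ a b fun _ _ h k => Quotient.sound ⟨h, k⟩
  le_total a b := Quotient.inductionOn₂ a b fun p q => EchelonedSpace.le_total p q
  toDecidableLE := Classical.decRel _

theorem eta_le_eta {X : Type u} [EchelonedSpace X] (p q : X × X) :
    eta p ≤ eta q ↔ le p q := Iff.rfl

/-- The smallest element of `E(X)`, the class of the identical pairs. -/
noncomputable instance (X : Type u) [EchelonedSpace X] : OrderBot (Echeloning X) where
  bot := eta (Classical.choice (nonempty (X := X)), Classical.choice (nonempty (X := X)))
  bot_le a := Quotient.inductionOn a fun p => diag_le _ p.1 p.2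

theorem eta_swap {X : Type u} [EchelonedSpace X] (x y : X) : eta (x, y) = eta (y, x) :=
  Quotient.sound ⟨le_swap x y, le_swap y x⟩

theorem eta_ne_bot {X : Type u} [EchelonedSpace X] {x y : X} (h : x ≠ y) :
    eta (x, y) ≠ ⊥ := fun he => h (eq_of_le_diag _ _ _ ((eta_le_eta _ _).1 (le_of_eq he)))

/-- The set of colours `E(X) ∖ {⊥}`. -/
abbrev Colours (X : Type u) [EchelonedSpace X] : Type u := {c : Echeloning X // c ≠ ⊥}

/-- The language with a single relation symbol, which is quaternary. -/
inductive EchelonRel : ℕ → Type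
  | le : EchelonRel 4

/-- The relational signature of echeloned spaces. -/
def lang : Language := ⟨fun _ => Empty, EchelonRel⟩

instance : lang.IsRelational := fun _ => inferInstanceAs (IsEmpty Empty)

/-- The relational structure of an echeloned space. -/
instance toStructure (X : Type u) [EchelonedSpace X] : lang.Structure X where
  funMap := fun f => Empty.elim f
  RelMap := fun r => match r with
    | EchelonRel.le => fun v => EchelonedSpace.le (v 0, v 1) (v 2, v 3)

/-- The class of finite echeloned spaces. Since the age of a relational structure in Mathlib
always contains the empty structure, the empty structure is added to the class. -/
def finiteSpaces : Set (CategoryTheory.Bundled.{u} lang.Structure) :=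
  {M | Finite M ∧ (IsEmpty M ∨ ∃ e : EchelonedSpace M, M.str = @toStructure M e)}

/-- `F` is a countable universal homogeneous echeloned space, i.e. a Fraïssé limit of the class
of finite echeloned spaces. -/
def IsUniversalHomogeneous (F : Type u) [Countable F] [EchelonedSpace F] : Prop :=
  Language.IsFraisseLimit finiteSpaces.{u} F

end EchelonedSpace

/-! ### Edge-coloured complete graphs -/

/-- A `C`-coloured graph on `V`: a map from the set of two-element subsets of `V` to `C`. -/
structure ColouredGraph (C V : Type u) where
  chi : {e : Sym2 V // ¬ e.IsDiag} → C

namespace ColouredGraph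

variable {C V W : Type u}

/-- The colour of the edge `{x, y}`. -/
def colour (G : ColouredGraph C V) (x y : V) (h : x ≠ y) : C :=
  G.chi ⟨s(x, y), fun hd => h (Sym2.mk_isDiag_iff.1 hd)⟩

/-- Two `C`-coloured graphs are isomorphic. -/
def Isomorphic (G : ColouredGraph C V) (H : ColouredGraph C W) : Prop :=
  ∃ f : V ≃ W, ∀ (x y : V) (h : x ≠ y),
    H.colour (f x) (f y) (fun he => h (f.injective he)) = G.colour x y h

/-- One binary relation symbol for every colour. -/
inductive ColourRel (C : Type u) : ℕ → Type u
  | rho (c : C) : ColourRel C 2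

/-- The relational signature of `C`-coloured graphs. -/
def lang (C : Type u) : Language := ⟨fun _ => Empty, ColourRel C⟩

instance (C : Type u) : (lang C).IsRelational := fun _ => inferInstanceAs (IsEmpty Empty)

/-- The relational structure of a `C`-coloured graph:
`ρ_c = {(u, v) : u ≠ v, χ {u, v} = c}`. -/
@[reducible] def toStructure (G : ColouredGraph C V) : (lang C).Structure V where
  funMap := fun f => Empty.elim f
  RelMap := fun r => match r with
    | ColourRel.rho c => fun v => ∃ h : v 0 ≠ v 1, G.colour (v 0) (v 1) h = c

/-- The class of finite `C`-coloured graphs. -/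
def finiteGraphs (C : Type u) : Set (CategoryTheory.Bundled.{u} (lang C).Structure) :=
  {M | Finite M ∧ ∃ G : ColouredGraph C M, M.str = G.toStructure}

/-- `G` is a countable universal homogeneous `C`-coloured graph, i.e. a Fraïssé limit of the class
of finite `C`-coloured graphs. -/
def IsUniversalHomogeneous [Countable V] (G : ColouredGraph C V) : Prop :=
  letI : (lang C).Structure V := G.toStructure
  Language.IsFraisseLimit (finiteGraphs C) V

end ColouredGraph

/-! ### The coloured graphs of an echeloned space -/

namespace EchelonedSpace

variable (X : Type u) [EchelonedSpace X]

/-- The complete graph on `X` in which the edge `{u, v}` has the colour `η(u, v)`. -/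
def colouredGraph : ColouredGraph (Colours X) X where
  chi e := ⟨Sym2.lift ⟨fun x y => eta (x, y), eta_swap⟩ e.1, by
    obtain ⟨e, he⟩ := e
    induction e with
    | _ x y => exact eta_ne_bot fun h => he (Sym2.mk_isDiag_iff.2 h)⟩

open Classical in
/-- For a finite set `S` of colours, the complete graph on `X` in which an edge keeps its colour
`η(u, v)` if this lies in `S` and gets an extra colour `none` otherwise. -/
noncomputable def restrictedGraph (S : Finset (Colours X)) : ColouredGraph (Option S) X where
  chi e := if h : (colouredGraph X).chi e ∈ S then some ⟨(colouredGraph X).chi e, h⟩ else none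

/-- The graph on `X` whose edges are the pairs `{u, v}` with `η(u, v) = c`. -/
def monochromaticGraph (c : Colours X) : SimpleGraph X where
  Adj u v := eta (u, v) = c.1
  symm := ⟨fun u v h => (eta_swap v u).trans h⟩
  loopless := ⟨fun u h => c.2 (h.symm.trans (le_bot_iff.1 (diag_le u _ _)))⟩

end EchelonedSpace

/-- The Rado graph: for `m < n`, the numbers `m` and `n` are adjacent if and only if the `m`-th
binary digit of `n` is one. -/
def radoGraph : SimpleGraph ℕ where
  Adj m n := (m < n ∧ n.testBit m = true) ∨ (n < m ∧ m.testBit n = true)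
  symm := ⟨fun _ _ h => h.symm⟩
  loopless := ⟨fun n h => by
    rcases h with h | h
    · exact lt_irrefl n h.1
    · exact lt_irrefl n h.1⟩

/-!
The argument rests on one-point extension properties.

A coloured graph `G` on a countable set in which every assignment of colours to a finite set of
vertices is realised by a new vertex (`ColouredGraph.HasExtensionProperty`) is a Fraïssé limit of
all finite coloured graphs: a finite partial isomorphism from any coloured graph into `G` extends to
any further point, so Mathlib's back-and-forth applies
(`ColouredGraph.HasExtensionProperty.isUniversalHomogeneous`). Uniqueness of Fraïssé limits then
gives the isomorphisms.

*Existence of `F`.* A distance on `ℕ` with positive rational values off the diagonal, which realises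
all assignments of positive distances to finite sets (`exists_generic_distance`), induces an echelon that is
universal and homogeneous. Indeed, a finite partial isomorphism of echeloned spaces is the same as
an injection together with a finite partial isomorphism between the orders of distances; the latter
extends to new distances since `ℚ` is dense without endpoints
(`StrictMonoOn.exists_extend_rat`), and the former by genericity (`EchelonedSpace.isExtensionPair`).

*Properties of `F`.* There is no triangle inequality, so a finite `A ⊆ F` may be enlarged by a point
with arbitrary distances to `A`, taken in any linear order containing `E(F)`; universality and
homogeneity realise the new point in `F` (`EchelonedSpace.IsUniversalHomogeneous.exists_point`).
If the prescribed distances are colours of `F`, enlarging `A` by pairs that represent them forces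
the new point to have these very colours, which is the extension property of the coloured graph.
A point at a new, largest distance shows that no finite set exhausts the colours, so that `none` can
be realised in the restricted graphs. The restriction to one colour `c` gives the extension property
of the graph of colour `c`. The Rado graph has this property too
(`radoGraph_hasExtensionProperty`), and two countable graphs with it are isomorphic: they are
complete graphs coloured by truth values, and the uniqueness of Fraïssé limits applies.
-/

/-! ### Partial isomorphisms of relational structures -/

namespace FirstOrder.Language

open Structure Substructure

/-- The map `g` restricts to an isomorphism from the set `S` onto its image, for a relational
language. -/
def IsPartialIso (L : Language) {M N : Type*} [L.Structure M] [L.Structure N] (S : Set M)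
    (g : M → N) : Prop :=
  Set.InjOn g S ∧ ∀ (n : ℕ) (r : L.Relations n) (v : Fin n → M), (∀ i, v i ∈ S) →
    (RelMap r (g ∘ v) ↔ RelMap r v)

variable {L : Language} {M N : Type*} [L.Structure M] [L.Structure N]

/-- In a relational language every set carries a substructure, so the extension of partial
equivalences reduces to that of maps that are partial isomorphisms on finite sets. -/
theorem isExtensionPair_of_isRelational [L.IsRelational] [Nonempty N]
    (H : ∀ (S : Set M), S.Finite → ∀ g : M → N, L.IsPartialIso S g → ∀ m ∉ S,
      ∃ g' : M → N, Set.EqOn g' g S ∧ L.IsPartialIso (insert m S) g') :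
    L.IsExtensionPair M N := by
  classical
  rw [isExtensionPair_iff_exists_embedding_closure_singleton_sup]
  intro S hS f m
  have hsub : ∀ x ∈ closure L {m} ⊔ S, x ∈ insert m (S : Set M) := by
    intro x hx
    have hle : closure L {m} ⊔ S ≤ closure L (insert m (S : Set M)) :=
      sup_le (closure_mono (by simp))
        ((closure_eq S).symm.le.trans (closure_mono (Set.subset_insert _ _)))
    exact (mem_closure_iff_of_isRelational L _ _).1 (hle hx)
  by_cases hm : m ∈ S
  · have hle : closure L {m} ⊔ S ≤ S := by
      intro x hx
      rcases hsub x hx with rfl | h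
      exacts [hm, h]
    exact ⟨f.comp (inclusion hle), by ext; rfl⟩
  · have hfin : Finite S := hS.finite
    let g : M → N := fun x => if h : x ∈ S then f ⟨x, h⟩ else Classical.arbitrary N
    have hg : ∀ x : S, g x = f x := fun x => dif_pos x.2
    obtain ⟨g', heq, hinj, hrel⟩ := H S (Set.toFinite _) g
      ⟨fun x hx y hy h => by
        have : f ⟨x, hx⟩ = f ⟨y, hy⟩ := by rw [← hg, ← hg]; exact h
        exact congrArg Subtype.val (f.injective this), fun n r v hv => by
        have : g ∘ v = f ∘ fun i => ⟨v i, hv i⟩ := funext fun i => hg ⟨v i, hv i⟩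
        rw [this, f.map_rel]
        rfl⟩ m hm
    refine ⟨⟨⟨fun x => g' x, fun x y h => Subtype.ext (hinj (hsub _ x.2) (hsub _ y.2) h)⟩,
      fun f => isEmptyElim f, fun r v => ?_⟩, ?_⟩
    · exact hrel _ r (fun i => v i) fun i => hsub _ (v i).2
    · ext x
      exact ((heq x.2).trans (hg x)).symm

/-- A structure `V` is a Fraïssé limit of a class `K` of finite relational structures if `K` contains
all finite structures embedding into `V`, and finite partial isomorphisms from `V` or a member of `K`
to `V` extend to any further point. -/
theorem isFraisseLimit_of_isExtensionPair {L : Language} [L.IsRelational] {V : Type*}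
    [L.Structure V] [Countable V] [IsEmpty (L.Relations 0)]
    {K : Set (CategoryTheory.Bundled L.Structure)} (hfin : ∀ M ∈ K, Finite M)
    (hK : ∀ M : CategoryTheory.Bundled L.Structure, Finite M → Nonempty (M ↪[L] V) → M ∈ K)
    (hext : ∀ M ∈ K, L.IsExtensionPair M V) (hV : L.IsExtensionPair V V) :
    IsFraisseLimit K V where
  ultrahomogeneous := (isUltrahomogeneous_iff_IsExtensionPair cg_of_countable).2 hV
  age := by
    ext M
    refine ⟨fun h => hK M h.1.finite h.2, fun h => ?_⟩
    have := hfin M h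
    obtain ⟨f, -⟩ := embedding_from_cg (L := L) cg_of_countable default (hext M h)
    exact ⟨FG.of_finite, ⟨f⟩⟩

end FirstOrder.Language

open FirstOrder.Language

/-! ### Coloured graphs with the extension property -/

namespace ColouredGraph

variable {C V W : Type u}

instance : IsEmpty ((lang C).Relations 0) := ⟨fun r => nomatch r⟩

theorem colour_comm (G : ColouredGraph C V) (x y : V) (h : x ≠ y) :
    G.colour x y h = G.colour y x h.symm := by
  unfold colour
  congr 2
  exact Sym2.eq_swap

/-- Every assignment of colours to a finite set of vertices is realised by a new vertex. -/
def HasExtensionProperty (G : ColouredGraph C V) : Prop :=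
  ∀ (A : Finset V) (f : V → C), ∃ x, ∀ a ∈ A, ∃ h : x ≠ a, G.colour x a h = f a

/-- The coloured graph induced along an injective map. -/
def comap (G : ColouredGraph C V) (f : W ↪ V) : ColouredGraph C W where
  chi e := G.chi ⟨e.1.map f, fun h => e.2 (by
    obtain ⟨e, he⟩ := e
    induction e with
    | _ x y => simpa using h)⟩

theorem isPartialIso_iff (G : ColouredGraph C V) (H : ColouredGraph C W) (S : Set V) (g : V → W) :
    letI := G.toStructure
    letI := H.toStructure
    IsPartialIso (lang C) S g ↔ ∀ x ∈ S, ∀ y ∈ S, ∀ h : x ≠ y,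
      ∃ h' : g x ≠ g y, H.colour (g x) (g y) h' = G.colour x y h := by
  let := G.toStructure
  let := H.toStructure
  constructor
  · rintro ⟨hinj, hrel⟩ x hx y hy h
    exact (hrel 2 (ColourRel.rho (G.colour x y h)) ![x, y]
      (by intro i; fin_cases i <;> assumption)).2 ⟨h, rfl⟩
  · intro hg
    refine ⟨fun x hx y hy h => by_contra fun hne => (hg x hx y hy hne).1 h, ?_⟩
    rintro _ ⟨c⟩ v hv
    constructor
    · rintro ⟨h, hc⟩
      have hne : v 0 ≠ v 1 := fun e => h (congrArg g e)
      exact ⟨hne, (hg _ (hv 0) _ (hv 1) hne).2.symm.trans hc⟩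
    · rintro ⟨h, hc⟩
      obtain ⟨h', hc'⟩ := hg _ (hv 0) _ (hv 1) h
      exact ⟨h', hc'.trans hc⟩

theorem HasExtensionProperty.nonempty [Nonempty C] {G : ColouredGraph C V}
    (hG : G.HasExtensionProperty) : Nonempty V :=
  ⟨(hG ∅ fun _ => Classical.arbitrary C).choose⟩

/-- A finite partial isomorphism into a coloured graph with the extension property extends to any
further point. -/
theorem HasExtensionProperty.isExtensionPair [Nonempty C] (G : ColouredGraph C V)
    {H : ColouredGraph C W} (hH : H.HasExtensionProperty) :
    letI := G.toStructure
    letI := H.toStructure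
    (lang C).IsExtensionPair V W := by
  classical
  let := G.toStructure
  let := H.toStructure
  have := hH.nonempty
  refine isExtensionPair_of_isRelational fun S hS g hg m hm => ?_
  have hinj := hg.1
  rw [isPartialIso_iff] at hg
  have : Nonempty V := ⟨m⟩
  obtain ⟨y, hy⟩ := hH (hS.toFinset.image g) fun b =>
    if h : m ≠ Function.invFunOn g S b then G.colour m _ h else Classical.arbitrary C
  have hy' : ∀ x ∈ S, ∀ h : m ≠ x, ∃ h' : y ≠ g x, H.colour y (g x) h' = G.colour m x h := by
    intro x hx h
    obtain ⟨h', hc⟩ := hy (g x) (Finset.mem_image_of_mem _ (hS.mem_toFinset.2 hx))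
    refine ⟨h', hc.trans ?_⟩
    have hinv : Function.invFunOn g S (g x) = x := hinj.leftInvOn_invFunOn hx
    simp only [hinv, dif_pos h]
  have hS' : ∀ x ∈ S, Function.update g m y x = g x := fun x hx =>
    Function.update_of_ne (ne_of_mem_of_not_mem hx hm) _ _
  refine ⟨Function.update g m y, hS', (isPartialIso_iff _ _ _ _).2 ?_⟩
  rintro a (rfl | ha) b (rfl | hb) h
  · exact absurd rfl h
  · simpa [hS' b hb] using hy' b hb h
  · obtain ⟨h', hc⟩ := hy' a ha h.symm
    simpa [hS' a ha, colour_comm H (g a), colour_comm G a] using ⟨h'.symm, hc⟩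
  · simpa [hS' a ha, hS' b hb] using hg a ha b hb h

theorem HasExtensionProperty.isUniversalHomogeneous [Nonempty C] [Countable V]
    {G : ColouredGraph C V} (hG : G.HasExtensionProperty) : G.IsUniversalHomogeneous := by
  let := G.toStructure
  refine isFraisseLimit_of_isExtensionPair (fun M h => h.1) ?_ ?_ (hG.isExtensionPair G)
  · rintro ⟨M, str⟩ hfin ⟨f⟩
    refine ⟨hfin, G.comap f.toEmbedding, ?_⟩
    refine Structure.ext (funext fun n => funext fun r => isEmptyElim r) ?_
    funext n r v
    obtain ⟨c⟩ := r
    refine (propext (f.map_rel (ColourRel.rho c) v)).symm.trans (propext ?_)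
    exact ⟨fun ⟨h, hc⟩ => ⟨fun e => h (congrArg f e), hc⟩, fun ⟨h, hc⟩ => ⟨f.injective.ne h, hc⟩⟩
  · rintro ⟨M, str⟩ ⟨-, H, hH⟩
    have h := hG.isExtensionPair H
    rwa [← hH] at h

theorem IsUniversalHomogeneous.isomorphic [Countable V] [Countable W] {G : ColouredGraph C V}
    {H : ColouredGraph C W} (hG : G.IsUniversalHomogeneous) (hH : H.IsUniversalHomogeneous) :
    G.Isomorphic H := by
  let := G.toStructure
  let := H.toStructure
  obtain ⟨f⟩ := IsFraisseLimit.nonempty_equiv hG hH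
  refine ⟨f.toEquiv, fun x y h => ?_⟩
  obtain ⟨_, hc⟩ := (f.map_rel (ColourRel.rho (G.colour x y h)) ![x, y]).2 ⟨h, rfl⟩
  exact hc

end ColouredGraph

/-! ### The Rado graph -/

namespace SimpleGraph

/-- Every assignment of truth values to a finite set of vertices is the adjacency to a new
vertex. -/
def HasExtensionProperty {V : Type*} (Γ : SimpleGraph V) : Prop :=
  ∀ (A : Finset V) (p : V → Prop), ∃ x ∉ A, ∀ a ∈ A, (Γ.Adj x a ↔ p a)

/-- A graph, viewed as a complete graph whose edges are coloured by truth values. -/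
def toColouredGraph {V : Type u} (Γ : SimpleGraph V) : ColouredGraph (ULift.{u} Prop) V where
  chi e := ⟨e.1 ∈ Γ.edgeSet⟩

theorem HasExtensionProperty.toColouredGraph {V : Type u} {Γ : SimpleGraph V}
    (h : Γ.HasExtensionProperty) : Γ.toColouredGraph.HasExtensionProperty := by
  intro A f
  obtain ⟨x, hx, hadj⟩ := h A fun a => (f a).down
  exact ⟨x, fun a ha => ⟨fun e => hx (e ▸ ha), ULift.ext _ _ (propext (hadj a ha))⟩⟩

theorem HasExtensionProperty.nonempty_iso {V W : Type u} [Countable V] [Countable W]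
    {Γ : SimpleGraph V} {Δ : SimpleGraph W} (hΓ : Γ.HasExtensionProperty)
    (hΔ : Δ.HasExtensionProperty) : Nonempty (Γ ≃g Δ) := by
  obtain ⟨f, hf⟩ := hΓ.toColouredGraph.isUniversalHomogeneous.isomorphic
    hΔ.toColouredGraph.isUniversalHomogeneous
  refine ⟨f, fun {x y} => ?_⟩
  rcases eq_or_ne x y with rfl | h
  · simp
  · exact iff_of_eq (congrArg ULift.down (hf x y h))

theorem HasExtensionProperty.comap_equiv {V W : Type*} {Γ : SimpleGraph V}
    (h : Γ.HasExtensionProperty) (e : W ≃ V) : (Γ.comap e).HasExtensionProperty := by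
  intro A p
  obtain ⟨x, hx, hadj⟩ := h (A.map e.toEmbedding) fun v => p (e.symm v)
  refine ⟨e.symm x, fun hA => hx (by simpa using Finset.mem_map_of_mem e.toEmbedding hA),
    fun a ha => ?_⟩
  simpa using hadj (e a) (Finset.mem_map_of_mem e.toEmbedding ha)

end SimpleGraph

theorem radoGraph_hasExtensionProperty : radoGraph.HasExtensionProperty := by
  classical
  intro A p
  obtain ⟨N, hN⟩ := A.exists_nat_subset_range
  -- The top digit makes the new vertex larger than all elements of `A`.
  let n := Nat.ofBits fun i : Fin (N + 1) => decide (i.1 = N ∨ p i)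
  have htop : n.testBit N = true := by simp [n, Nat.testBit_ofBits_lt]
  have hn : N < n := Nat.lt_two_pow_self.trans_le (Nat.ge_two_pow_of_testBit htop)
  have hlt : ∀ a ∈ A, a < N := fun a ha => Finset.mem_range.1 (hN ha)
  refine ⟨n, fun h => (hlt n h).not_gt hn, fun a ha => ?_⟩
  have hbit : n.testBit a = true ↔ p a := by
    have h := Nat.testBit_ofBits_lt (fun i : Fin (N + 1) => decide (i.1 = N ∨ p i)) a
      (by have := hlt a ha; omega)
    change (Nat.ofBits _).testBit a = true ↔ _
    rw [h]
    simp [(hlt a ha).ne]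
  have han := (hlt a ha).trans hn
  simp [radoGraph, han, han.not_gt, hbit]

/-! ### A universal homogeneous echeloned space -/

/-- A strictly monotone map from a finite subset of a linear order to `ℚ` extends to any larger
finite subset. -/
theorem StrictMonoOn.exists_extend_rat {α : Type*} [LinearOrder α] {s : Finset α} {g : α → ℚ}
    (hg : StrictMonoOn g s) (t : Finset α) :
    ∃ g' : α → ℚ, Set.EqOn g' g s ∧ StrictMonoOn g' (s ∪ t : Finset α) := by
  induction t using Finset.induction_on with
  | empty => exact ⟨g, fun _ _ => rfl, by simpa using hg⟩
  | insert x t hx ih =>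
    obtain ⟨g', heq, hmono⟩ := ih
    rw [Finset.union_insert]
    by_cases hxs : x ∈ s ∪ t
    · exact ⟨g', heq, by rwa [Finset.insert_eq_of_mem hxs]⟩
    · obtain ⟨q, hlo, hhi⟩ := Order.exists_between_finsets
        (((s ∪ t).filter (· < x)).image g') (((s ∪ t).filter (x < ·)).image g') (by
          simp only [Finset.mem_image, Finset.mem_filter]
          rintro _ ⟨a, ⟨ha, hax⟩, rfl⟩ _ ⟨b, ⟨hb, hxb⟩, rfl⟩
          exact hmono ha hb (hax.trans hxb))
      have hup : ∀ a ∈ s ∪ t, Function.update g' x q a = g' a := fun a ha =>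
        Function.update_of_ne (ne_of_mem_of_not_mem ha hxs) _ _
      refine ⟨Function.update g' x q,
        fun a ha => (hup a (Finset.mem_union_left _ ha)).trans (heq ha), ?_⟩
      intro a ha b hb hab
      rcases Finset.mem_insert.1 ha with rfl | ha' <;> rcases Finset.mem_insert.1 hb with rfl | hb'
      · exact absurd hab (lt_irrefl _)
      · rw [hup b hb', Function.update_self]
        exact hhi _ (Finset.mem_image_of_mem _ (Finset.mem_filter.2 ⟨hb', hab⟩))
      · rw [hup a ha', Function.update_self]
        exact hlo _ (Finset.mem_image_of_mem _ (Finset.mem_filter.2 ⟨ha', hab⟩))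
      · rw [hup a ha', hup b hb']
        exact hmono ha' hb' hab

/-- A symmetric rational distance that is positive off the diagonal and realises every assignment of
positive distances to a finite set of points. -/
structure IsGenericDistance {V : Type*} (d : V → V → ℚ) : Prop where
  self : ∀ x, d x x = 0
  symm : ∀ x y, d x y = d y x
  pos : ∀ x y, x ≠ y → 0 < d x y
  ext : ∀ (A : Finset V) (f : V → ℚ), (∀ a ∈ A, 0 < f a) → ∃ x ∉ A, ∀ a ∈ A, d x a = f a

theorem exists_generic_distance : ∃ d : ℕ → ℕ → ℚ, IsGenericDistance d := by
  classical
  -- The second component makes every finitely supported function occur infinitely often.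
  obtain ⟨h, hsurj⟩ := exists_surjective_nat ((ℕ →₀ ℚ) × ℕ)
  have hinf : ∀ (f : ℕ →₀ ℚ) (N : ℕ), ∃ n, N < n ∧ (h n).1 = f := by
    intro f N
    have : {n | (h n).1 = f}.Infinite := by
      refine Set.Infinite.of_image (fun n => (h n).2) (Set.infinite_univ.mono fun k _ => ?_)
      obtain ⟨n, hn⟩ := hsurj (f, k)
      exact ⟨n, by simp [hn], by simp [hn]⟩
    obtain ⟨n, hn, hlt⟩ := this.exists_gt N
    exact ⟨n, hlt, hn⟩
  -- The distance of `m < n` is read off the `n`-th function at `m`.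
  let q : ℕ → ℕ → ℚ := fun m n => (h (max m n)).1 (min m n)
  refine ⟨fun m n => if m = n then 0 else if 0 < q m n then q m n else 1, by simp, ?_, ?_, ?_⟩
  · intro x y
    simp only [q, max_comm x, min_comm x, eq_comm (a := x)]
  · intro x y hxy
    simp only [if_neg hxy]
    split_ifs with hq
    exacts [hq, one_pos]
  · intro A f hf
    obtain ⟨N, hN⟩ := A.exists_nat_subset_range
    obtain ⟨n, hn, hfn⟩ := hinf (Finsupp.onFinset A (fun a => if a ∈ A then f a else 0)
      fun a => by simp +contextual) N
    have hlt : ∀ a ∈ A, a < n := fun a ha => (Finset.mem_range.1 (hN ha)).trans hn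
    refine ⟨n, fun hA => (hlt n hA).false, fun a ha => ?_⟩
    have hq : q n a = f a := by
      simp [q, max_eq_left (hlt a ha).le, min_eq_right (hlt a ha).le, hfn, ha]
    simp [(hlt a ha).ne', hq, hf a ha]

theorem IsGenericDistance.comap_equiv {V W : Type*} {d : V → V → ℚ} (hd : IsGenericDistance d)
    (e : W ≃ V) : IsGenericDistance fun x y => d (e x) (e y) where
  self x := hd.self _
  symm x y := hd.symm _ _
  pos x y h := hd.pos _ _ (e.injective.ne h)
  ext A f hf := by
    obtain ⟨x, hx, hdx⟩ := hd.ext (A.map e.toEmbedding) (fun v => f (e.symm v))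
      fun v hv => hf _ (by simpa using hv)
    refine ⟨e.symm x, fun hA => hx (by simpa using Finset.mem_map_of_mem e.toEmbedding hA),
      fun a ha => ?_⟩
    simpa using hdx (e a) (Finset.mem_map_of_mem e.toEmbedding ha)

namespace EchelonedSpace

instance : IsEmpty (lang.Relations 0) := ⟨fun r => nomatch r⟩

/-- The echelon that compares the values of a distance in a linear order. -/
abbrev ofDist {X L : Type*} [Nonempty X] [LinearOrder L] (d : X → X → L)
    (diag_le : ∀ x y z, d x x ≤ d y z) (eq_of_le : ∀ x y z, d y z ≤ d x x → y = z)
    (symm : ∀ x y, d x y = d y x) : EchelonedSpace X where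
  nonempty := inferInstance
  le p q := d p.1 p.2 ≤ d q.1 q.2
  le_refl _ := _root_.le_refl _
  le_trans _ _ _ := _root_.le_trans
  le_total _ _ := _root_.le_total _ _
  diag_le := diag_le
  eq_of_le_diag := eq_of_le
  le_swap x y := (symm x y).le

theorem eta_self {X : Type u} [EchelonedSpace X] (x : X) : eta (x, x) = ⊥ :=
  le_bot_iff.1 (diag_le x _ _)

theorem eta_eq_bot_iff {X : Type u} [EchelonedSpace X] {x y : X} : eta (x, y) = ⊥ ↔ x = y :=
  ⟨fun h => by_contra fun hne => eta_ne_bot hne h, fun h => h ▸ eta_self x⟩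

theorem isPartialIso_iff {X : Type*} {Y : Type*} [EchelonedSpace X] [EchelonedSpace Y] (S : Set X)
    (g : X → Y) : IsPartialIso lang S g ↔ ∀ a ∈ S, ∀ b ∈ S, ∀ c ∈ S, ∀ d ∈ S,
      (eta (g a, g b) ≤ eta (g c, g d) ↔ eta (a, b) ≤ eta (c, d)) := by
  constructor
  · rintro ⟨-, hrel⟩ a ha b hb c hc d hd
    exact hrel 4 EchelonRel.le ![a, b, c, d] (by intro i; fin_cases i <;> assumption)
  · intro hg
    refine ⟨fun x hx y hy h => ?_, ?_⟩
    · have := (hg x hx y hy x hx x hx).1 (by rw [h])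
      exact eq_of_le_diag _ _ _ this
    · rintro _ ⟨⟩ v hv
      exact hg _ (hv 0) _ (hv 1) _ (hv 2) _ (hv 3)

/-- A finite partial isomorphism into an echelon given by a generic rational distance extends to any
further point: its effect on distances is a finite partial map into `ℚ`, which is extended to the
distances from the new point, and genericity realises the resulting values. -/
theorem isExtensionPair {M : Type*} {V : Type*} [EchelonedSpace M] [EchelonedSpace V]
    {d : V → V → ℚ} (hd : IsGenericDistance d)
    (hle : ∀ a b x y : V, eta (a, b) ≤ eta (x, y) ↔ d a b ≤ d x y) :
    lang.IsExtensionPair M V := by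
  classical
  have : Nonempty V := EchelonedSpace.nonempty
  refine isExtensionPair_of_isRelational fun S hS g hg m hm => ?_
  have hinj := hg.1
  rw [isPartialIso_iff] at hg
  have : Nonempty M := ⟨m⟩
  -- The map that `g` induces on distances; it is normalised at `⊥` also when `S` is empty.
  have hφ : ∀ e : Echeloning M, ∃ q : ℚ, (e = ⊥ → q = 0) ∧
      ∀ a ∈ S, ∀ b ∈ S, eta (a, b) = e → d (g a) (g b) = q := by
    intro e
    by_cases he : e = ⊥
    · refine ⟨0, fun _ => rfl, fun a _ b _ h => ?_⟩
      rw [eta_eq_bot_iff.1 (h.trans he), hd.self]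
    · by_cases hex : ∃ a ∈ S, ∃ b ∈ S, eta (a, b) = e
      · obtain ⟨a, ha, b, hb, hab⟩ := hex
        refine ⟨d (g a) (g b), fun h => absurd h he, fun x hx y hy hxy => ?_⟩
        exact le_antisymm
          ((hle _ _ _ _).1 ((hg x hx y hy a ha b hb).2 (hxy.trans hab.symm).le))
          ((hle _ _ _ _).1 ((hg a ha b hb x hx y hy).2 (hab.trans hxy.symm).le))
      · exact ⟨0, fun _ => rfl, fun a ha b hb h => absurd ⟨a, ha, b, hb, h⟩ hex⟩
  choose φ hφ0 hφS using hφ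
  let s : Finset (Echeloning M) :=
    insert ⊥ ((hS.toFinset ×ˢ hS.toFinset).image eta)
  have hs : ∀ a ∈ S, ∀ b ∈ S, eta (a, b) ∈ s := fun a ha b hb =>
    Finset.mem_insert_of_mem (Finset.mem_image_of_mem _ (by simp [ha, hb]))
  have hs' : ∀ e ∈ s, e ≠ ⊥ → ∃ a ∈ S, ∃ b ∈ S, eta (a, b) = e := by
    intro e he hne
    obtain ⟨⟨a, b⟩, hab, rfl⟩ := Finset.mem_image.1 ((Finset.mem_insert.1 he).resolve_left hne)
    simp only [Finset.mem_product, Set.Finite.mem_toFinset] at hab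
    exact ⟨a, hab.1, b, hab.2, rfl⟩
  have hmono : StrictMonoOn φ s := by
    intro e he e' he' hlt
    obtain ⟨a, ha, b, hb, rfl⟩ := hs' e' he' (ne_bot_of_gt hlt)
    rw [← hφS _ a ha b hb rfl]
    by_cases hbot : e = ⊥
    · rw [hφ0 e hbot]
      refine hd.pos _ _ fun h => ne_bot_of_gt hlt (eta_eq_bot_iff.2 (hinj ha hb h))
    · obtain ⟨x, hx, y, hy, rfl⟩ := hs' e he hbot
      rw [← hφS _ x hx y hy rfl]
      exact lt_of_not_ge fun h => hlt.not_ge ((hg a ha b hb x hx y hy).1 ((hle _ _ _ _).2 h))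
  obtain ⟨ψ, hψφ, hψ⟩ := hmono.exists_extend_rat (hS.toFinset.image fun x => eta (m, x))
  have hmS : ∀ x ∈ S, eta (m, x) ∈ s ∪ hS.toFinset.image fun x => eta (m, x) := fun x hx =>
    Finset.mem_union_right _ (Finset.mem_image_of_mem _ (hS.mem_toFinset.2 hx))
  have hbot : (⊥ : Echeloning M) ∈ s ∪ hS.toFinset.image fun x => eta (m, x) :=
    Finset.mem_union_left _ (Finset.mem_insert_self _ _)
  have hψ0 : ψ ⊥ = 0 := (hψφ (Finset.mem_insert_self _ _)).trans (hφ0 _ rfl)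
  obtain ⟨y, -, hy⟩ := hd.ext (hS.toFinset.image g) (fun b => ψ (eta (m, Function.invFunOn g S b)))
    (by
      simp only [Finset.mem_image, Set.Finite.mem_toFinset]
      rintro _ ⟨x, hx, rfl⟩
      rw [hinj.leftInvOn_invFunOn hx, ← hψ0]
      exact hψ hbot (hmS x hx) (bot_lt_iff_ne_bot.2 (eta_ne_bot fun h => hm (h ▸ hx))))
  have hy' : ∀ x ∈ S, d y (g x) = ψ (eta (m, x)) := by
    intro x hx
    rw [hy _ (Finset.mem_image_of_mem _ (hS.mem_toFinset.2 hx)), hinj.leftInvOn_invFunOn hx]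
  have hS' : ∀ x ∈ S, Function.update g m y x = g x := fun x hx =>
    Function.update_of_ne (ne_of_mem_of_not_mem hx hm) _ _
  have key : ∀ a ∈ insert m S, ∀ b ∈ insert m S,
      eta (a, b) ∈ (s ∪ hS.toFinset.image fun x => eta (m, x)) ∧
      d (Function.update g m y a) (Function.update g m y b) = ψ (eta (a, b)) := by
    rintro a (rfl | ha) b (rfl | hb)
    · rw [eta_self, hd.self, hψ0]
      exact ⟨hbot, rfl⟩
    · rw [Function.update_self, hS' b hb, hy' b hb]
      exact ⟨hmS b hb, rfl⟩
    · rw [Function.update_self, hS' a ha, hd.symm, hy' a ha, eta_swap]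
      exact ⟨hmS a ha, rfl⟩
    · rw [hS' a ha, hS' b hb, hψφ (hs a ha b hb)]
      exact ⟨Finset.mem_union_left _ (hs a ha b hb), hφS _ a ha b hb rfl⟩
  refine ⟨Function.update g m y, hS', (isPartialIso_iff _ _).2 fun a ha b hb x hx z hz => ?_⟩
  rw [hle, (key a ha b hb).2, (key x hx z hz).2]
  exact hψ.le_iff_le (key a ha b hb).1 (key x hx z hz).1

theorem isUniversalHomogeneous_of_isGenericDistance {V : Type u} [Countable V] [EchelonedSpace V]
    {d : V → V → ℚ} (hd : IsGenericDistance d)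
    (hle : ∀ a b x y : V, eta (a, b) ≤ eta (x, y) ↔ d a b ≤ d x y) :
    IsUniversalHomogeneous V := by
  have : Nonempty V := EchelonedSpace.nonempty
  refine isFraisseLimit_of_isExtensionPair (fun M h => h.1) ?_ ?_ (isExtensionPair hd hle)
  · rintro ⟨M, str⟩ hfin ⟨f⟩
    refine ⟨hfin, (isEmpty_or_nonempty M).imp id fun (_ : Nonempty M) => ?_⟩
    refine ⟨ofDist (X := M) (fun x y => eta (f x, f y)) (fun x y z => diag_le _ _ _)
      (fun x y z h => f.injective (eq_of_le_diag _ _ _ h)) fun x y => eta_swap _ _, ?_⟩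
    refine Structure.ext (funext fun n => funext fun r => isEmptyElim r) ?_
    funext n r v
    obtain ⟨⟩ := r
    exact (propext (f.map_rel EchelonRel.le v)).symm
  · rintro ⟨M, str⟩ ⟨-, hM | ⟨e, he⟩⟩
    · exact fun _ m => isEmptyElim (α := M) m
    · have h := @isExtensionPair M V e _ d hd hle
      rwa [← he] at h

theorem exists_isUniversalHomogeneous : ∃ (F : Type u) (_ : Countable F) (_ : EchelonedSpace F),
    IsUniversalHomogeneous F := by
  obtain ⟨d, hd⟩ := exists_generic_distance
  replace hd := hd.comap_equiv Equiv.ulift.{u}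
  have hnonneg : ∀ x y : ULift.{u} ℕ, 0 ≤ d x.down y.down := fun x y =>
    (eq_or_ne x y).elim (fun h => h ▸ (hd.self x).ge) fun h => (hd.pos x y h).le
  let : EchelonedSpace (ULift.{u} ℕ) := ofDist (fun x y => d x.down y.down)
    (fun x y z => (hd.self x).trans_le (hnonneg y z))
    (fun x y z h => by_contra fun hne => ((hd.pos y z hne).trans_le h).ne' (hd.self x)) hd.symm
  exact ⟨ULift.{u} ℕ, inferInstance, inferInstance,
    isUniversalHomogeneous_of_isGenericDistance hd fun _ _ _ _ => Iff.rfl⟩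

/-! ### The coloured graphs of a universal homogeneous echeloned space -/

/-- A finite subset `A` of a universal homogeneous echeloned space `F` can be enlarged by a point of
`F` with any prescribed distances `f` to `A`. The prescribed distances live in a linear order that
contains `E(F)` by `φ`; only their order relative to the distances within `A` is realised. -/
theorem IsUniversalHomogeneous.exists_point {F : Type u} [Countable F] [EchelonedSpace F]
    (hF : IsUniversalHomogeneous F) {L : Type*} [LinearOrder L] {φ : Echeloning F → L}
    (hφ : StrictMono φ) (A : Finset F) (f : F → L) (hf : ∀ a ∈ A, φ ⊥ < f a) :
    ∃ x ∉ A, ∀ a ∈ A, ∀ b ∈ A, ∀ c ∈ A,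
      (eta (x, a) ≤ eta (b, c) ↔ f a ≤ φ (eta (b, c))) ∧
      (eta (b, c) ≤ eta (x, a) ↔ φ (eta (b, c)) ≤ f a) := by
  let d : Option A → Option A → L
    | some a, some b => φ (eta (a.1, b.1))
    | none, none => φ ⊥
    | some a, none => f a
    | none, some a => f a
  have hself : ∀ x, d x x = φ ⊥ := by
    rintro (_ | x)
    exacts [rfl, congrArg φ (eta_self _)]
  let : EchelonedSpace (Option A) := ofDist d
    (by
      intro x y z
      rw [hself]
      rcases y with _ | y <;> rcases z with _ | z
      exacts [le_rfl, (hf z z.2).le, (hf y y.2).le, hφ.monotone bot_le])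
    (by
      intro x y z h
      rw [hself] at h
      rcases y with _ | y <;> rcases z with _ | z
      · rfl
      · exact absurd h (hf z z.2).not_ge
      · exact absurd h (hf y y.2).not_ge
      · exact congrArg some (Subtype.ext (eta_eq_bot_iff.1 (le_bot_iff.1 (hφ.le_iff_le.1 h)))))
    (by
      rintro (_ | y) (_ | z)
      exacts [rfl, rfl, rfl, congrArg φ (eta_swap _ _)])
  have hage : Nonempty (Option A ↪[lang] F) := by
    have : (⟨Option A, inferInstance⟩ : CategoryTheory.Bundled lang.Structure) ∈ lang.age F := by
      rw [hF.age]
      exact ⟨inferInstanceAs (Finite (Option A)), Or.inr ⟨inferInstance, rfl⟩⟩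
    exact this.2
  let S : lang.Substructure F := ⟨A, fun f => isEmptyElim f⟩
  have hfin : Finite S := A.finite_toSet
  let i : S ↪[lang] Option A := ⟨⟨fun x => some ⟨x.1, x.2⟩, fun x y h =>
    Subtype.ext (congrArg Subtype.val (Option.some.inj h))⟩, fun f => isEmptyElim f, by
      rintro _ ⟨⟩ v
      exact hφ.le_iff_le⟩
  obtain ⟨g, hg⟩ := hF.ultrahomogeneous.extend_embedding Structure.FG.of_finite S.subtype i
  have hgA : ∀ a (ha : a ∈ A), g (some ⟨a, ha⟩) = a := fun a ha =>
    (DFunLike.congr_fun hg (⟨a, ha⟩ : S)).symm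
  have hgle : ∀ x y z w, eta (g x, g y) ≤ eta (g z, g w) ↔ d x y ≤ d z w := fun x y z w =>
    g.map_rel EchelonRel.le ![x, y, z, w]
  refine ⟨g none, fun h => ?_, fun a ha b hb c hc => ?_⟩
  · exact Option.some_ne_none _ (g.injective (hgA _ h))
  · have h1 := hgle none (some ⟨a, ha⟩) (some ⟨b, hb⟩) (some ⟨c, hc⟩)
    have h2 := hgle (some ⟨b, hb⟩) (some ⟨c, hc⟩) none (some ⟨a, ha⟩)
    rw [hgA, hgA, hgA] at h1 h2
    exact ⟨h1, h2⟩

theorem exists_eta_eq {X : Type u} [EchelonedSpace X] (e : Echeloning X) :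
    ∃ p : X × X, eta p = e := Quotient.exists_rep e

theorem colour_restrictedGraph_eq_some {X : Type u} [EchelonedSpace X]
    {S : Finset (Colours X)} {x y : X} (h : x ≠ y) (s : S) :
    (restrictedGraph X S).colour x y h = some s ↔ (colouredGraph X).colour x y h = s.1 := by
  classical
  change (if h : _ then _ else _) = _ ↔ _
  split_ifs with hS
  · simp [Subtype.ext_iff, ColouredGraph.colour]
  · refine iff_of_false (by simp) fun e => hS ?_
    exact Eq.mpr (congrArg (· ∈ S) e) s.2

variable {F : Type u} [Countable F] [EchelonedSpace F]

theorem IsUniversalHomogeneous.colouredGraph_hasExtensionProperty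
    (hF : IsUniversalHomogeneous F) : (colouredGraph F).HasExtensionProperty := by
  classical
  intro A f
  choose p hp using exists_eta_eq (X := F)
  -- The set `A` together with pairs that represent the prescribed colours.
  let B := A ∪ A.image (fun a => (p (f a).1).1) ∪ A.image (fun a => (p (f a).1).2)
  obtain ⟨x, hx, hB⟩ := hF.exists_point strictMono_id B (fun a => (f a).1)
    fun a _ => bot_lt_iff_ne_bot.2 (f a).2
  refine ⟨x, fun a ha => ?_⟩
  have haB : a ∈ B := by simp [B, ha]
  have h1B : (p (f a).1).1 ∈ B :=
    Finset.mem_union_left _ (Finset.mem_union_right _ (Finset.mem_image_of_mem _ ha))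
  have h2B : (p (f a).1).2 ∈ B := Finset.mem_union_right _ (Finset.mem_image_of_mem _ ha)
  obtain ⟨h1, h2⟩ := hB a haB _ h1B _ h2B
  simp only [Prod.mk.eta, hp, id_eq] at h1 h2
  exact ⟨fun e => hx (e ▸ haB), Subtype.ext (le_antisymm (h1.2 le_rfl) (h2.2 le_rfl))⟩

theorem IsUniversalHomogeneous.exists_colour_notMem (hF : IsUniversalHomogeneous F)
    (S : Finset (Colours F)) : ∃ c, c ∉ S := by
  classical
  choose p hp using exists_eta_eq (X := F)
  obtain ⟨o⟩ : Nonempty F := EchelonedSpace.nonempty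
  let B := insert o (S.image (fun c => (p c.1).1) ∪ S.image (fun c => (p c.1).2))
  have hoB : o ∈ B := Finset.mem_insert_self _ _
  -- A point at a distance above all those in `B`.
  obtain ⟨x, hx, hB⟩ := hF.exists_point (WithTop.coe_strictMono (α := Echeloning F)) B
    (fun _ => ⊤) fun _ _ => WithTop.coe_lt_top _
  refine ⟨⟨eta (x, o), eta_ne_bot fun e => hx (e ▸ hoB)⟩, fun hS => ?_⟩
  have h1B : (p (eta (x, o))).1 ∈ B := Finset.mem_insert_of_mem
    (Finset.mem_union_left _ (Finset.mem_image.2 ⟨_, hS, rfl⟩))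
  have h2B : (p (eta (x, o))).2 ∈ B := Finset.mem_insert_of_mem
    (Finset.mem_union_right _ (Finset.mem_image.2 ⟨_, hS, rfl⟩))
  have h := (hB o hoB _ h1B _ h2B).1
  rw [Prod.mk.eta, hp] at h
  exact absurd (h.1 le_rfl) (by simp)

theorem IsUniversalHomogeneous.restrictedGraph_hasExtensionProperty
    (hF : IsUniversalHomogeneous F) (S : Finset (Colours F)) :
    (restrictedGraph F S).HasExtensionProperty := by
  intro A f
  obtain ⟨c, hc⟩ := hF.exists_colour_notMem S
  obtain ⟨x, hx⟩ := hF.colouredGraph_hasExtensionProperty A fun a => (f a).elim c Subtype.val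
  refine ⟨x, fun a ha => ?_⟩
  obtain ⟨h, hxa⟩ := hx a ha
  refine ⟨h, Option.ext fun s => ?_⟩
  rw [colour_restrictedGraph_eq_some, hxa]
  cases hfa : f a with
  | none =>
    exact iff_of_false (fun e => ne_of_mem_of_not_mem s.2 hc e.symm) (Option.some_ne_none s).symm
  | some t => exact Subtype.ext_iff.symm.trans (Option.some_inj).symm

theorem IsUniversalHomogeneous.monochromaticGraph_hasExtensionProperty
    (hF : IsUniversalHomogeneous F) (c : Colours F) :
    (monochromaticGraph F c).HasExtensionProperty := by
  classical
  intro A p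
  let s : ({c} : Finset (Colours F)) := ⟨c, Finset.mem_singleton_self c⟩
  obtain ⟨x, hx⟩ := hF.restrictedGraph_hasExtensionProperty {c} A fun a =>
    if p a then some s else none
  refine ⟨x, fun hA => (hx x hA).1 rfl, fun a ha => ?_⟩
  obtain ⟨h, hxa⟩ := hx a ha
  have hadj : (monochromaticGraph F c).Adj x a ↔ (colouredGraph F).colour x a h = s.1 :=
    Subtype.ext_iff (a1 := (colouredGraph F).colour x a h).symm
  rw [hadj, ← colour_restrictedGraph_eq_some, hxa]
  simp

end EchelonedSpace

theorem mainTheorem6 :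
    (∃ (F : Type u) (_ : Countable F) (_ : EchelonedSpace F),
      EchelonedSpace.IsUniversalHomogeneous F) ∧
    ∀ (F : Type u) [Countable F] [EchelonedSpace F], EchelonedSpace.IsUniversalHomogeneous F →
      ((EchelonedSpace.colouredGraph F).IsUniversalHomogeneous ∧
        ∀ (T : Type u) [Countable T] (G : ColouredGraph (EchelonedSpace.Colours F) T),
          G.IsUniversalHomogeneous → (EchelonedSpace.colouredGraph F).Isomorphic G) ∧
      (∀ S : Finset (EchelonedSpace.Colours F), S.Nonempty →
        (EchelonedSpace.restrictedGraph F S).IsUniversalHomogeneous ∧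
        ∀ (T : Type u) [Countable T] (G : ColouredGraph (Option S) T),
          G.IsUniversalHomogeneous → (EchelonedSpace.restrictedGraph F S).Isomorphic G) ∧
      ∀ c : EchelonedSpace.Colours F,
        Nonempty (EchelonedSpace.monochromaticGraph F c ≃g radoGraph) := by
  refine ⟨EchelonedSpace.exists_isUniversalHomogeneous, fun F _ _ hF =>
    ⟨?_, fun S _ => ?_, fun c => ?_⟩⟩
  · have : Nonempty (EchelonedSpace.Colours F) := ⟨(hF.exists_colour_notMem ∅).choose⟩
    have h := hF.colouredGraph_hasExtensionProperty.isUniversalHomogeneous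
    exact ⟨h, fun T _ G hG => h.isomorphic hG⟩
  · have h := (hF.restrictedGraph_hasExtensionProperty S).isUniversalHomogeneous
    exact ⟨h, fun T _ G hG => h.isomorphic hG⟩
  · obtain ⟨f⟩ := (hF.monochromaticGraph_hasExtensionProperty c).nonempty_iso
      (radoGraph_hasExtensionProperty.comap_equiv Equiv.ulift.{u})
    exact ⟨f.trans (SimpleGraph.Iso.comap Equiv.ulift radoGraph)⟩
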